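/- Let $n \ge 1$ and $r \ge 0$ be integers and let $P(\lambda)=\sum_{i=0}^k \lambda^i A_i$, $A_i\in\mathbb{C}^{n\times n}$, be a matrix polynomial with Smith form $P(\lambda)=E(\lambda)D(\lambda)F(\lambda)$, where $E,F$ are $n\times n$ matrix polynomials whose determinants are nonzero constants and $D=\mathrm{diag}(d_1,\dots,d_t,0,\dots,0)$ with monic polynomials $d_i$ such that $d_{i-1}$ divides $d_i$. Assume that $P$ is regular, that is, $t=n$. A scalar $\lambda_0\in\mathbb{C}$ is called an eigenvalue of $P$ if $\lambda-\lambda_0$ divides some $d_i(\lambda)$, and its algebraic multiplicity is the sum over $i=1,\dots,t$ of the exponents of $\lambda-\lambda_0$ in $d_i(\lambda)$. Let $\gamma_1,\dots,\gamma_r$ be positive real numbers and let $T_\gamma(P,\lambda_0)$ be the $(r+1)n\times(r+1)n$ block lower-triangular matrix whose $n\times n$ blocks, for $0\le j\le i\le r$, are $$\bigl[T_\gamma(P,\lambda_0)\bigr]_{i,j}=\Bigl(\prod_{l=j+1}^{i}\gamma_l\Bigr)\frac{P^{(i-j)}(\lambda_0)}{(i-j)!},$$ and whose blocks with $i<j$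 are zero. Then, for every $\lambda_0\in\mathbb{C}$, $\lambda_0$ is an eigenvalue of $P$ of algebraic multiplicity at least $r+1$ if and only if $$\operatorname{rank} T_\gamma(P,\lambda_0)\le (r+1)(n-1).$$ -/

import Mathlib

open scoped Polynomial

namespace MatPoly

/-- An `n × n` matrix polynomial whose determinant is a nonzero constant. -/
def IsUnimodular {n : ℕ} (E : Matrix (Fin n) (Fin n) ℂ[X]) : Prop :=
  ∃ c : ℂ, c ≠ 0 ∧ E.det = Polynomial.C c

/-- `d` is the diagonal of a Smith form of `P`: `P = E * diag(d) * F` with `E`, `F` unimodular,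
the nonzero diagonal entries are monic, and each entry divides the next ones (so that, since `0`
divides only `0`, the zero entries come last). -/
def IsSmithDiagonal {n : ℕ} (P : Matrix (Fin n) (Fin n) ℂ[X]) (d : Fin n → ℂ[X]) : Prop :=
  (∃ E F : Matrix (Fin n) (Fin n) ℂ[X],
    IsUnimodular E ∧ IsUnimodular F ∧ P = E * Matrix.diagonal d * F) ∧
  (∀ i, d i ≠ 0 → (d i).Monic) ∧
  (∀ i j, i ≤ j → d i ∣ d j)

/-! ### Existence of the Smith form -/

/-- Equivalence of square matrices over `ℂ[X]`. -/
def MEquiv {n : ℕ} (A B : Matrix (Fin n) (Fin n) ℂ[X]) : Prop :=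
  ∃ U V : Matrix (Fin n) (Fin n) ℂ[X], IsUnit U ∧ IsUnit V ∧ B = U * A * V

theorem MEquiv.refl {n : ℕ} (A : Matrix (Fin n) (Fin n) ℂ[X]) : MEquiv A A :=
  ⟨1, 1, isUnit_one, isUnit_one, by simp⟩

theorem MEquiv.trans {n : ℕ} {A B D : Matrix (Fin n) (Fin n) ℂ[X]}
    (h : MEquiv A B) (k : MEquiv B D) : MEquiv A D := by
  obtain ⟨U, V, hU, hV, rfl⟩ := h
  obtain ⟨U', V', hU', hV', rfl⟩ := k
  exact ⟨U' * U, V * V', hU'.mul hU, hV.mul hV', by simp only [Matrix.mul_assoc]⟩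

theorem MEquiv.symm {n : ℕ} {A B : Matrix (Fin n) (Fin n) ℂ[X]}
    (h : MEquiv A B) : MEquiv B A := by
  obtain ⟨_, _, ⟨U, rfl⟩, ⟨V, rfl⟩, rfl⟩ := h
  refine ⟨(U⁻¹ : (Matrix (Fin n) (Fin n) ℂ[X])ˣ), (V⁻¹ : (Matrix (Fin n) (Fin n) ℂ[X])ˣ),
    Units.isUnit _, Units.isUnit _, ?_⟩
  simp only [← mul_assoc, Units.inv_mul, one_mul]
  simp only [mul_assoc, Units.mul_inv, mul_one]

theorem MEquiv.transpose {n : ℕ} {A B : Matrix (Fin n) (Fin n) ℂ[X]}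
    (h : MEquiv A B) : MEquiv A.transpose B.transpose := by
  obtain ⟨U, V, hU, hV, rfl⟩ := h
  refine ⟨V.transpose, U.transpose, ?_, ?_, ?_⟩
  · rwa [Matrix.isUnit_iff_isUnit_det, Matrix.det_transpose, ← Matrix.isUnit_iff_isUnit_det]
  · rwa [Matrix.isUnit_iff_isUnit_det, Matrix.det_transpose, ← Matrix.isUnit_iff_isUnit_det]
  · simp only [Matrix.transpose_mul, Matrix.mul_assoc]

theorem MEquiv.addRow {n : ℕ} (A : Matrix (Fin n) (Fin n) ℂ[X]) (k : Fin n)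
    (c : Fin n → ℂ[X]) (hc : c k = 0) :
    MEquiv A (Matrix.of fun i j => A i j + c i * A k j) := by
  have hN : Matrix.vecMulVec c (Pi.single k 1) * Matrix.vecMulVec c (Pi.single k 1) = 0 := by
    rw [Matrix.vecMulVec_mul_vecMulVec]; simp [hc]
  refine ⟨1 + Matrix.vecMulVec c (Pi.single k 1), 1, ?_, isUnit_one, ?_⟩
  · refine IsUnit.of_mul_eq_one (1 - Matrix.vecMulVec c (Pi.single k 1)) ?_
    rw [mul_sub, mul_one, add_mul, one_mul, hN]; simp
  · rw [Matrix.mul_one, Matrix.add_mul, Matrix.one_mul]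
    ext1 i j
    simp [Matrix.mul_apply, Matrix.vecMulVec_apply, Pi.single_apply]

theorem MEquiv.swap {n : ℕ} (A : Matrix (Fin n) (Fin n) ℂ[X]) (i j k : Fin n) :
    ∃ B, MEquiv A B ∧ B k k = A i j := by
  refine ⟨(Equiv.swap k i).permMatrix ℂ[X] * A * (Equiv.swap j k).permMatrix ℂ[X],
    ⟨_, _, ?_, ?_, rfl⟩, ?_⟩
  · rw [Matrix.isUnit_iff_isUnit_det, Matrix.det_permutation]
    rcases Int.units_eq_one_or (Equiv.Perm.sign (Equiv.swap k i)) with h | h <;> simp [h]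
  · rw [Matrix.isUnit_iff_isUnit_det, Matrix.det_permutation]
    rcases Int.units_eq_one_or (Equiv.Perm.sign (Equiv.swap j k)) with h | h <;> simp [h]
  · simp [Equiv.Perm.permMatrix, PEquiv.toMatrix_toPEquiv_mul, PEquiv.mul_toMatrix_toPEquiv]

/-- The `(0,0)` entry is nonzero and of least degree among the nonzero entries of all equivalent
matrices. -/
def IsLeast00 {n : ℕ} (A : Matrix (Fin (n + 1)) (Fin (n + 1)) ℂ[X]) : Prop :=
  A 0 0 ≠ 0 ∧ ∀ B, MEquiv A B → ∀ i j, B i j ≠ 0 → ¬ (B i j).degree < (A 0 0).degree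

theorem IsLeast00.transpose {n : ℕ} {A : Matrix (Fin (n + 1)) (Fin (n + 1)) ℂ[X]}
    (h : IsLeast00 A) : IsLeast00 A.transpose :=
  ⟨h.1, fun B hB i j hij => h.2 B.transpose (by simpa using hB.transpose) j i hij⟩

theorem IsLeast00.congr {n : ℕ} {A B : Matrix (Fin (n + 1)) (Fin (n + 1)) ℂ[X]}
    (h : IsLeast00 A) (hAB : MEquiv A B) (h0 : B 0 0 = A 0 0) : IsLeast00 B :=
  ⟨h0 ▸ h.1, fun D hD i j hij => h0 ▸ h.2 D (hAB.trans hD) i j hij⟩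

theorem exists_isLeast00 {n : ℕ} (A : Matrix (Fin (n + 1)) (Fin (n + 1)) ℂ[X]) (hA : A ≠ 0) :
    ∃ B, MEquiv A B ∧ IsLeast00 B := by
  obtain ⟨i, j, hij⟩ : ∃ i j, A i j ≠ 0 := by
    by_contra! h
    exact hA (by ext1 i j; exact h i j)
  obtain ⟨x, ⟨hx, B, hB, i', j', rfl⟩, hmin⟩ := Polynomial.degree_lt_wf.has_min
    {x : ℂ[X] | x ≠ 0 ∧ ∃ B, MEquiv A B ∧ ∃ i j, B i j = x} ⟨A i j, hij, A, .refl A, i, j, rfl⟩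
  obtain ⟨D, hD, hD0⟩ := MEquiv.swap B i' j' 0
  refine ⟨D, hB.trans hD, hD0 ▸ hx, fun E hE k l hkl => hD0 ▸ ?_⟩
  exact hmin _ ⟨hkl, E, (hB.trans hD).trans hE, k, l, rfl⟩

theorem IsLeast00.dvd_col {n : ℕ} {A : Matrix (Fin (n + 1)) (Fin (n + 1)) ℂ[X]}
    (h : IsLeast00 A) (i : Fin (n + 1)) : A 0 0 ∣ A i 0 := by
  rcases eq_or_ne i 0 with rfl | hi
  · exact dvd_rfl
  by_contra hnd
  have h1 := h.2 _ (MEquiv.addRow A 0 (Pi.single i (-(A i 0 / A 0 0)))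
    (by simp [hi.symm])) i 0
  have h2 : A i 0 + -(A i 0 / A 0 0) * A 0 0 = A i 0 % A 0 0 := by
    rw [EuclideanDomain.mod_eq_sub_mul_div]; ring
  simp only [Matrix.of_apply, Pi.single_eq_same, h2] at h1
  refine h1 (fun h0 => hnd (EuclideanDomain.mod_eq_zero.mp h0)) ?_
  exact EuclideanDomain.mod_lt (A i 0) h.1

theorem IsLeast00.dvd_row {n : ℕ} {A : Matrix (Fin (n + 1)) (Fin (n + 1)) ℂ[X]}
    (h : IsLeast00 A) (j : Fin (n + 1)) : A 0 0 ∣ A 0 j :=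
  h.transpose.dvd_col j

theorem IsLeast00.clear_col {n : ℕ} {A : Matrix (Fin (n + 1)) (Fin (n + 1)) ℂ[X]}
    (h : IsLeast00 A) : ∃ B, MEquiv A B ∧ IsLeast00 B ∧ (∀ j, B 0 j = A 0 j) ∧
      ∀ i, i ≠ 0 → B i 0 = 0 := by
  choose c hc using h.dvd_col
  refine ⟨_, MEquiv.addRow A 0 (fun i => if i = 0 then 0 else -c i) (by simp),
    h.congr (MEquiv.addRow A 0 _ (by simp)) (by simp), by simp, fun i hi => ?_⟩
  simp only [Matrix.of_apply, hi, if_false]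
  linear_combination hc i

/-- The block diagonal matrix `diag(x, M)`. -/
noncomputable def bdiag {n : ℕ} (x : ℂ[X]) (M : Matrix (Fin n) (Fin n) ℂ[X]) :
    Matrix (Fin (n + 1)) (Fin (n + 1)) ℂ[X] :=
  Matrix.of (Fin.cons (Fin.cons x 0) fun i => Fin.cons 0 (M i))

theorem bdiag_mul {n : ℕ} (x y : ℂ[X]) (M N : Matrix (Fin n) (Fin n) ℂ[X]) :
    bdiag x M * bdiag y N = bdiag (x * y) (M * N) := by
  ext1 i j
  refine Fin.cases ?_ (fun i => ?_) i <;> refine Fin.cases ?_ (fun j => ?_) j <;>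
    simp [bdiag, Matrix.mul_apply, Fin.sum_univ_succ]

theorem bdiag_diagonal {n : ℕ} (x : ℂ[X]) (d : Fin n → ℂ[X]) :
    bdiag x (Matrix.diagonal d) = Matrix.diagonal (Fin.cons x d : Fin (n + 1) → ℂ[X]) := by
  ext1 i j
  refine Fin.cases ?_ (fun i => ?_) i <;> refine Fin.cases ?_ (fun j => ?_) j <;>
    simp [bdiag, Matrix.diagonal_apply, Fin.succ_ne_zero, (Fin.succ_ne_zero _).symm]

theorem bdiag_one {n : ℕ} : bdiag 1 (1 : Matrix (Fin n) (Fin n) ℂ[X]) = 1 := by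
  rw [← Matrix.diagonal_one, bdiag_diagonal, ← Matrix.diagonal_one]
  congr 1
  ext1 i
  refine Fin.cases rfl (fun i => rfl) i

theorem isUnit_bdiag {n : ℕ} {x : ℂ[X]} {M : Matrix (Fin n) (Fin n) ℂ[X]}
    (hx : IsUnit x) (hM : IsUnit M) : IsUnit (bdiag x M) := by
  obtain ⟨x, rfl⟩ := hx
  obtain ⟨M, rfl⟩ := hM
  refine IsUnit.of_mul_eq_one (bdiag (x⁻¹ : ℂ[X]ˣ) (M⁻¹ : (Matrix (Fin n) (Fin n) ℂ[X])ˣ)) ?_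
  rw [bdiag_mul, Units.mul_inv, Units.mul_inv, bdiag_one]

theorem IsLeast00.split {n : ℕ} {A : Matrix (Fin (n + 1)) (Fin (n + 1)) ℂ[X]}
    (h : IsLeast00 A) : ∃ (q : ℂ[X]) (M : Matrix (Fin n) (Fin n) ℂ[X]),
      MEquiv A (bdiag q M) ∧ q ≠ 0 ∧ ∀ i j, q ∣ M i j := by
  obtain ⟨B, hAB, hB, -, hB0⟩ := h.clear_col
  obtain ⟨D, hBD, hD, hDr, hDc⟩ := hB.transpose.clear_col
  have hD' := hD.transpose
  have hAD : MEquiv A D.transpose := hAB.trans (by simpa using hBD.transpose)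
  have hr : ∀ j, j ≠ 0 → D.transpose 0 j = 0 := hDc
  have hc : ∀ i, i ≠ 0 → D.transpose i 0 = 0 := fun i hi => by
    simpa using (hDr i).trans (hB0 i hi)
  generalize D.transpose = Q at *
  refine ⟨Q 0 0, Q.submatrix Fin.succ Fin.succ, ?_, hD'.1, fun i j => ?_⟩
  · convert hAD
    ext1 i j
    refine Fin.cases ?_ (fun i => ?_) i <;> refine Fin.cases ?_ (fun j => ?_) j <;>
      simp [bdiag, hr, hc, Fin.succ_ne_zero]
  · have hne : (i.succ : Fin (n + 1)) ≠ 0 := Fin.succ_ne_zero i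
    have hR := hD'.congr (MEquiv.addRow Q i.succ (Pi.single 0 1) (by simp))
      (by simp [hc])
    simpa [hc, hr, Fin.succ_ne_zero] using hR.dvd_row j.succ

theorem exists_mequiv_diagonal (n : ℕ) : ∀ A : Matrix (Fin n) (Fin n) ℂ[X],
    ∃ d : Fin n → ℂ[X], MEquiv A (Matrix.diagonal d) ∧
      (∀ i, d i ≠ 0 → (d i).Monic) ∧ ∀ i j, i ≤ j → d i ∣ d j := by
  induction n with
  | zero => exact fun A => ⟨0, by rw [Subsingleton.elim (Matrix.diagonal 0) A]; exact .refl A,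
      fun i => i.elim0, fun i => i.elim0⟩
  | succ n ih =>
    intro A
    by_cases hA : A = 0
    · exact ⟨0, by rw [hA]; simpa using MEquiv.refl 0, by simp, by simp⟩
    obtain ⟨B, hAB, hB⟩ := exists_isLeast00 A hA
    obtain ⟨q, M, hBq, hq, hdvd⟩ := hB.split
    obtain ⟨d, ⟨U, V, hU, hV, hUV⟩, hmon, hch⟩ := ih M
    have hlc : q.leadingCoeff⁻¹ ≠ 0 := inv_ne_zero (Polynomial.leadingCoeff_ne_zero.mpr hq)
    have hcu : IsUnit (Polynomial.C q.leadingCoeff⁻¹) := Polynomial.isUnit_C.mpr hlc.isUnit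
    have hqd : ∀ i, q ∣ d i := fun i => by
      have : d i = (U * M * V) i i := by rw [← hUV, Matrix.diagonal_apply_eq]
      rw [this, Matrix.mul_apply]
      refine Finset.dvd_sum fun k _ => Dvd.dvd.mul_right ?_ _
      rw [Matrix.mul_apply]
      exact Finset.dvd_sum fun l _ => Dvd.dvd.mul_left (hdvd l k) _
    refine ⟨Fin.cons (Polynomial.C q.leadingCoeff⁻¹ * q) d,
      (hAB.trans hBq).trans ⟨bdiag (Polynomial.C q.leadingCoeff⁻¹) U, bdiag 1 V,
        isUnit_bdiag hcu hU, isUnit_bdiag isUnit_one hV, ?_⟩, ?_, ?_⟩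
    · rw [bdiag_mul, bdiag_mul, mul_one, ← hUV, bdiag_diagonal]
    · intro i
      refine Fin.cases (fun _ => ?_) (fun i => hmon i) i
      rw [Fin.cons_zero, mul_comm]
      exact Polynomial.monic_mul_leadingCoeff_inv hq
    · intro i j
      refine Fin.cases (fun _ => ?_) (fun i => ?_) i
      · refine Fin.cases dvd_rfl (fun j => ?_) j
        simpa [hcu.mul_left_dvd] using hqd j
      · refine Fin.cases (fun h => absurd h (by simp)) (fun j h => ?_) j
        exact hch i j (by simpa using h)

theorem exists_isSmithDiagonal {n : ℕ} (P : Matrix (Fin n) (Fin n) ℂ[X]) :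
    ∃ d, IsSmithDiagonal P d := by
  obtain ⟨d, h, hmon, hch⟩ := exists_mequiv_diagonal n P
  have key : ∀ U : Matrix (Fin n) (Fin n) ℂ[X], IsUnit U → IsUnimodular U := fun U hU => by
    obtain ⟨c, hc, hcU⟩ := Polynomial.isUnit_iff.mp ((Matrix.isUnit_iff_isUnit_det U).mp hU)
    exact ⟨c, hc.ne_zero, hcU.symm⟩
  obtain ⟨U, V, hU, hV, hUV⟩ := h.symm
  exact ⟨d, ⟨U, V, key U hU, key V hV, hUV⟩, hmon, hch⟩

/-! ### Notions defined through the Smith form -/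

/-- The diagonal of the Smith form of `P`; its nonzero entries are the invariant polynomials
of `P`. -/
noncomputable def smithDiagonal {n : ℕ} (P : Matrix (Fin n) (Fin n) ℂ[X]) : Fin n → ℂ[X] :=
  Classical.choose (exists_isSmithDiagonal P)

open Classical in
/-- The number of invariant polynomials. -/
noncomputable def normalRank {n : ℕ} (P : Matrix (Fin n) (Fin n) ℂ[X]) : ℕ :=
  (Finset.univ.filter fun i => smithDiagonal P i ≠ 0).card

/-- `P` is regular if its normal rank equals its size. -/
def IsRegular {n : ℕ} (P : Matrix (Fin n) (Fin n) ℂ[X]) : Prop :=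
  normalRank P = n

/-- `(X - z) ^ c` is an elementary divisor of `P`: `c` is positive and is the exact exponent of
`X - z` in the factorization of one of the invariant polynomials. -/
def HasElementaryDivisor {n : ℕ} (P : Matrix (Fin n) (Fin n) ℂ[X]) (z : ℂ) (c : ℕ) : Prop :=
  0 < c ∧ ∃ i, smithDiagonal P i ≠ 0 ∧ (smithDiagonal P i).rootMultiplicity z = c

/-- `z` is a finite eigenvalue of `P`. -/
def IsEigenvalue {n : ℕ} (P : Matrix (Fin n) (Fin n) ℂ[X]) (z : ℂ) : Prop :=
  ∃ c, HasElementaryDivisor P z c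

open Classical in
/-- The sum of the exponents of `X - z` in all the invariant polynomials of `P`. -/
noncomputable def algebraicMultiplicity {n : ℕ} (P : Matrix (Fin n) (Fin n) ℂ[X]) (z : ℂ) : ℕ :=
  ∑ i with smithDiagonal P i ≠ 0, (smithDiagonal P i).rootMultiplicity z

/-! ### The block Toeplitz matrix -/

/-- The value at `z` of the `m`-th derivative of `P`. -/
noncomputable def derivAt {n : ℕ} (P : Matrix (Fin n) (Fin n) ℂ[X]) (m : ℕ) (z : ℂ) :
    Matrix (Fin n) (Fin n) ℂ :=
  P.map fun p => (Polynomial.derivative^[m] p).eval z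

/-- The `(r+1)n × (r+1)n` matrix `T_γ(P, z)`, with the entry in row `a` and column `b` of the block
`(i, j)`. With blocks counted from `0` and `γ = (γ 0, …, γ (r-1))`, the block `(i, j)` with `j ≤ i`
is `γ j * ⋯ * γ (i-1) * P^{(i-j)}(z) / (i-j)!`, and the blocks with `i < j` are zero. -/
noncomputable def blockToeplitz {n r : ℕ} (γ : Fin r → ℝ) (P : Matrix (Fin n) (Fin n) ℂ[X])
    (z : ℂ) : Matrix (Fin (r + 1) × Fin n) (Fin (r + 1) × Fin n) ℂ :=
  Matrix.of fun x y =>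
    if y.1 ≤ x.1 then
      (∏ t : Fin r with y.1.val ≤ t.val ∧ t.val < x.1.val, (γ t : ℂ)) *
        (derivAt P (x.1.val - y.1.val) z x.2 y.2 / ((x.1.val - y.1.val).factorial : ℂ))
    else 0

end MatPoly

namespace MatPoly

open Polynomial

/-! Conjugation by the diagonal matrix of partial products of `γ` removes the weights, so `T_γ` has
the rank of the plain block Toeplitz matrix of Taylor coefficients at `z` (`rank_blockToeplitz`).
That matrix is the image of `P` under a ring homomorphism: each entry is reduced modulo `(X -
z)^(r+1)`, with `X - z` acting as the nilpotent shift `N`. Units go to units, so `P` may be replaced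
by its Smith diagonal, and each `d k` by `(X - z)^(m k)`, where `m k` is its root multiplicity at
`z`. As `N ^ m` has rank `r + 1 - m` (truncated at zero), the rank is `∑ k, (r + 1 - m k)`, that is,
`(r + 1) * n - ∑ k, min (r + 1) (m k)`. It is at most `(r + 1) * (n - 1)` exactly when the sum of
minima, equivalently `∑ k, m k`, reaches `r + 1`. -/

/-! ### Toeplitz matrices of Taylor coefficients as a ring homomorphism -/

/-- The nilpotent matrix with ones just below the diagonal. -/
def lowerShift (r : ℕ) : Matrix (Fin (r + 1)) (Fin (r + 1)) ℂ :=
  Matrix.of fun i j => if i.val = j.val + 1 then 1 else 0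

theorem lowerShift_pow_apply (r m : ℕ) (i j : Fin (r + 1)) :
    (lowerShift r ^ m) i j = if i.val = j.val + m then 1 else 0 := by
  induction m generalizing i j with
  | zero => simp [Matrix.one_apply, Fin.ext_iff]
  | succ m ih =>
    have hs : ∀ c, lowerShift r c j = if c.val = j.val + 1 then 1 else 0 := fun _ => rfl
    rw [pow_succ, Matrix.mul_apply]
    simp only [ih, hs]
    -- If `j` is the last index, its column in the shift is zero, and `i = j + (m + 1)` is out of
    -- range too.
    by_cases hj : j.val + 1 < r + 1
    · rw [Finset.sum_eq_single ⟨j.val + 1, hj⟩]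
      · simp [add_assoc, add_comm 1 m]
      · intro c _ hc
        rw [if_neg (c := c.val = j.val + 1) fun h => hc (Fin.ext h), mul_zero]
      · simp
    · rw [if_neg (by omega)]
      refine Finset.sum_eq_zero fun c _ => ?_
      rw [if_neg (c := c.val = j.val + 1) (by omega), mul_zero]

theorem lowerShift_pow_succ_self (r : ℕ) : lowerShift r ^ (r + 1) = 0 := by
  ext1 i j
  rw [lowerShift_pow_apply, if_neg (by omega), Matrix.zero_apply]

/-- The algebra homomorphism sending `p` to the lower triangular Toeplitz matrix of the first
`r + 1` Taylor coefficients of `p` at `z`. -/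
noncomputable def taylorToeplitz (r : ℕ) (z : ℂ) :
    ℂ[X] →ₐ[ℂ] Matrix (Fin (r + 1)) (Fin (r + 1)) ℂ :=
  (aeval (lowerShift r)).comp (taylorAlgHom z)

theorem taylorToeplitz_apply (r : ℕ) (z : ℂ) (p : ℂ[X]) (i j : Fin (r + 1)) :
    taylorToeplitz r z p i j = if j ≤ i then (taylor z p).coeff (i.val - j.val) else 0 := by
  have h : taylorToeplitz r z p = aeval (lowerShift r) (taylor z p) := rfl
  rw [h, aeval_eq_sum_range, Matrix.sum_apply]
  simp only [Matrix.smul_apply, lowerShift_pow_apply, smul_eq_mul, mul_ite, mul_one, mul_zero]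
  split_ifs with hji
  · rw [Finset.sum_eq_single (i.val - j.val)]
    · rw [if_pos (by have := Fin.le_def.mp hji; omega)]
    · intro m _ hm
      rw [if_neg (by omega)]
    -- Here `i - j` exceeds the degree, so the coefficient vanishes.
    · intro hm
      rw [coeff_eq_zero_of_natDegree_lt (by rw [Finset.mem_range] at hm; omega), ite_self]
  · refine Finset.sum_eq_zero fun m _ => if_neg ?_
    have := Fin.lt_def.mp (not_le.mp hji)
    omega

theorem taylorToeplitz_X_sub_C (r : ℕ) (z : ℂ) :
    taylorToeplitz r z (X - C z) = lowerShift r := by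
  have h : taylorToeplitz r z (X - C z) = aeval (lowerShift r) (taylor z (X - C z)) := rfl
  rw [h, map_sub, taylor_X, taylor_C, add_sub_cancel_right, aeval_X]

/-- Apply the homomorphism to a Bézout identity for `(X - C z) ^ (r + 1)` and `q`: the power is sent
to zero, so an inverse of the image of `q` remains. -/
theorem isUnit_taylorToeplitz (r : ℕ) (z : ℂ) {q : ℂ[X]} (hq : ¬ (X - C z) ∣ q) :
    IsUnit (taylorToeplitz r z q) := by
  have hc : IsCoprime ((X - C z) ^ (r + 1)) q :=
    (((irreducible_X_sub_C z).coprime_iff_not_dvd).mpr hq).pow_left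
  obtain ⟨a, b, hab⟩ := hc
  have h := congrArg (taylorToeplitz r z) hab
  rw [map_add, map_mul, map_mul, map_pow, taylorToeplitz_X_sub_C, lowerShift_pow_succ_self,
    mul_zero, zero_add, map_one] at h
  exact IsUnit.of_mul_eq_one_right _ h

/-- The block Toeplitz ring homomorphism, with the blocks indexed by the second coordinate. -/
noncomputable def matTaylorToeplitz (n r : ℕ) (z : ℂ) :
    Matrix (Fin n) (Fin n) ℂ[X] →+* Matrix (Fin n × Fin (r + 1)) (Fin n × Fin (r + 1)) ℂ :=
  (Matrix.compRingEquiv (Fin n) (Fin (r + 1)) ℂ).toRingHom.comp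
    (taylorToeplitz r z).toRingHom.mapMatrix

theorem matTaylorToeplitz_apply {n r : ℕ} (z : ℂ) (P : Matrix (Fin n) (Fin n) ℂ[X])
    (x y : Fin n × Fin (r + 1)) :
    matTaylorToeplitz n r z P x y = taylorToeplitz r z (P x.1 y.1) x.2 y.2 := rfl

/-! ### Removing the weights -/

theorem derivAt_div_factorial {n : ℕ} (P : Matrix (Fin n) (Fin n) ℂ[X]) (m : ℕ) (z : ℂ)
    (a b : Fin n) :
    derivAt P m z a b / (m.factorial : ℂ) = (taylor z (P a b)).coeff m := by
  rw [taylor_coeff, derivAt, Matrix.map_apply, ← factorial_smul_hasseDeriv,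
    div_eq_iff (Nat.cast_ne_zero.mpr m.factorial_ne_zero)]
  simp [mul_comm]

/-- This exhibits the weight of block `(i, j)` as a quotient `g i / g j` of partial products, hence
as the effect of a diagonal conjugation. -/
theorem prod_lt_eq_mul_prod_lt {r : ℕ} (γ : Fin r → ℝ) {i j : ℕ} (hji : j ≤ i) :
    (∏ t : Fin r with t.val < i, (γ t : ℂ)) =
      (∏ t : Fin r with j ≤ t.val ∧ t.val < i, (γ t : ℂ)) * ∏ t : Fin r with t.val < j, (γ t : ℂ) := by
  rw [← Finset.prod_union]
  · refine Finset.prod_congr ?_ fun _ _ => rfl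
    ext t
    simp only [Finset.mem_filter, Finset.mem_union, Finset.mem_univ, true_and]
    omega
  · rw [Finset.disjoint_filter]
    intro t _ h
    omega

theorem rank_blockToeplitz {n r : ℕ} {γ : Fin r → ℝ} (hγ : ∀ i, γ i ≠ 0)
    (P : Matrix (Fin n) (Fin n) ℂ[X]) (z : ℂ) :
    (blockToeplitz γ P z).rank = (matTaylorToeplitz n r z P).rank := by
  have hG : IsUnit (Matrix.diagonal fun x : Fin n × Fin (r + 1) =>
      ∏ t : Fin r with t.val < x.2.val, (γ t : ℂ)).det := by
    rw [Matrix.det_diagonal, isUnit_iff_ne_zero, Finset.prod_ne_zero_iff]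
    exact fun x _ => Finset.prod_ne_zero_iff.mpr fun t _ => Complex.ofReal_ne_zero.mpr (hγ t)
  -- After the two index coordinates are swapped, the claim becomes `T_γ * G = G * T` with `G` the
  -- invertible diagonal matrix of partial products.
  rw [← Matrix.rank_submatrix _ (Equiv.prodComm (Fin n) (Fin (r + 1)))
      (Equiv.prodComm (Fin n) (Fin (r + 1))),
    ← Matrix.rank_mul_eq_left_of_isUnit_det _ _ hG,
    ← Matrix.rank_mul_eq_right_of_isUnit_det _ (matTaylorToeplitz n r z P) hG]
  congr 1
  ext1 x y
  rw [Matrix.mul_diagonal, Matrix.diagonal_mul, matTaylorToeplitz_apply, taylorToeplitz_apply]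
  simp only [blockToeplitz, Matrix.submatrix_apply, Matrix.of_apply, Equiv.prodComm_apply,
    Prod.fst_swap, Prod.snd_swap]
  split_ifs with h
  · rw [derivAt_div_factorial, prod_lt_eq_mul_prod_lt γ (Fin.le_def.mp h)]
    ring
  · simp

/-! ### Rank of the image of a Smith form -/

theorem IsUnimodular.isUnit {n : ℕ} {E : Matrix (Fin n) (Fin n) ℂ[X]} (h : IsUnimodular E) :
    IsUnit E := by
  obtain ⟨c, hc, hE⟩ := h
  rw [Matrix.isUnit_iff_isUnit_det, hE]
  exact isUnit_C.mpr hc.isUnit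

theorem rank_map_mul_mul {n r : ℕ} (z : ℂ) {E F : Matrix (Fin n) (Fin n) ℂ[X]}
    (hE : IsUnit (matTaylorToeplitz n r z E)) (hF : IsUnit (matTaylorToeplitz n r z F))
    (A : Matrix (Fin n) (Fin n) ℂ[X]) :
    (matTaylorToeplitz n r z (E * A * F)).rank = (matTaylorToeplitz n r z A).rank := by
  rw [map_mul, map_mul,
    Matrix.rank_mul_eq_left_of_isUnit_det _ _ ((Matrix.isUnit_iff_isUnit_det _).mp hF),
    Matrix.rank_mul_eq_right_of_isUnit_det _ _ ((Matrix.isUnit_iff_isUnit_det _).mp hE)]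

theorem matTaylorToeplitz_diagonal_apply {n r : ℕ} (z : ℂ) (d : Fin n → ℂ[X])
    (x y : Fin n × Fin (r + 1)) :
    matTaylorToeplitz n r z (Matrix.diagonal d) x y =
      if x.1 = y.1 then taylorToeplitz r z (d x.1) x.2 y.2 else 0 := by
  rw [matTaylorToeplitz_apply, Matrix.diagonal_apply]
  split_ifs <;> simp

theorem isUnit_matTaylorToeplitz_diagonal {n r : ℕ} (z : ℂ) {q : Fin n → ℂ[X]}
    (hq : ∀ k, ¬ (X - C z) ∣ q k) :
    IsUnit (matTaylorToeplitz n r z (Matrix.diagonal q)) := by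
  refine IsUnit.map (Matrix.compRingEquiv (Fin n) (Fin (r + 1)) ℂ).toRingHom
    (x := (taylorToeplitz r z).toRingHom.mapMatrix (Matrix.diagonal q)) ?_
  have h : (taylorToeplitz r z).toRingHom.mapMatrix (Matrix.diagonal q) =
      Matrix.diagonalRingHom (Fin n) _ fun k => taylorToeplitz r z (q k) := by
    ext1 k l
    rcases eq_or_ne k l with rfl | hkl
    · simp
    · simp [hkl]
  rw [h]
  exact IsUnit.map _ (Pi.isUnit_iff.mpr fun k => isUnit_taylorToeplitz r z (hq k))

-- The image `A` is a partial permutation matrix: column `(k, i)` has its only possible one in row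
-- `(k, i + m k)`. Hence `Aᴴ * A` is a diagonal 0/1 matrix, and the rank counts the pairs with `i +
-- m k < r + 1`.
open scoped ComplexOrder in
theorem rank_matTaylorToeplitz_diagonal_pow {n r : ℕ} (z : ℂ) (m : Fin n → ℕ) :
    (matTaylorToeplitz n r z (Matrix.diagonal fun k => (X - C z) ^ m k)).rank =
      ∑ k, (r + 1 - m k) := by
  classical
  rw [← Matrix.rank_conjTranspose_mul_self]
  have h : (matTaylorToeplitz n r z (Matrix.diagonal fun k => (X - C z) ^ m k)).conjTranspose *
      matTaylorToeplitz n r z (Matrix.diagonal fun k => (X - C z) ^ m k) =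
      Matrix.diagonal fun x => if x.2.val + m x.1 < r + 1 then 1 else 0 := by
    ext1 x y
    obtain ⟨k, i⟩ := x
    obtain ⟨l, j⟩ := y
    rw [Matrix.mul_apply, Fintype.sum_prod_type, Finset.sum_eq_single k]
    · simp only [Matrix.conjTranspose_apply, matTaylorToeplitz_diagonal_apply, map_pow,
        taylorToeplitz_X_sub_C, lowerShift_pow_apply, Matrix.diagonal_apply, Prod.mk.injEq]
      by_cases hkl : k = l
      · subst hkl
        by_cases hi : i.val + m k < r + 1
        · rw [Finset.sum_eq_single ⟨i.val + m k, hi⟩]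
          · simp [hi, Fin.ext_iff]
          · intro c _ hc
            simp [show ¬ c.val = i.val + m k from fun h => hc (Fin.ext h)]
          · simp
        · simp only [hi, if_false, ite_self]
          refine Finset.sum_eq_zero fun c _ => ?_
          simp [show ¬ c.val = i.val + m k by omega]
      · simp [hkl]
    · intro c _ hc
      simp [matTaylorToeplitz_diagonal_apply, hc]
    · simp
  rw [h, Matrix.rank_diagonal, Fintype.card_subtype]
  simp only [ne_eq, ite_eq_right_iff, one_ne_zero, imp_false, not_not]
  rw [Finset.card_filter, Fintype.sum_prod_type]
  refine Finset.sum_congr rfl fun k _ => ?_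
  rw [Fin.sum_univ_eq_sum_range (fun i => if i + m k < r + 1 then 1 else 0) (r + 1),
    ← Finset.card_filter]
  convert Finset.card_range (r + 1 - m k) using 2
  ext i
  simp only [Finset.mem_filter, Finset.mem_range]
  omega

theorem rank_matTaylorToeplitz_diagonal {n r : ℕ} (z : ℂ) {d : Fin n → ℂ[X]}
    (hd : ∀ k, d k ≠ 0) :
    (matTaylorToeplitz n r z (Matrix.diagonal d)).rank =
      ∑ k, (r + 1 - (d k).rootMultiplicity z) := by
  -- The cofactors `q k` do not vanish at `z`, so their diagonal matrix has invertible image and can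
  -- be dropped.
  choose q hq hqz using fun k => exists_eq_pow_rootMultiplicity_mul_and_not_dvd (d k) (hd k) z
  rw [← rank_matTaylorToeplitz_diagonal_pow z,
    ← rank_map_mul_mul z (E := 1) (by simp) (isUnit_matTaylorToeplitz_diagonal z hqz)
      (Matrix.diagonal fun k => (X - C z) ^ (d k).rootMultiplicity z),
    one_mul, Matrix.diagonal_mul_diagonal]
  congr 3
  exact _root_.funext hq

/-- The truncated defects of a family of naturals sum to at most `s * (card - 1)` exactly when the
family sums to at least `s`. -/
theorem sum_tsub_le_iff {n s : ℕ} (hn : 0 < n) (m : Fin n → ℕ) :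
    ∑ k, (s - m k) ≤ s * (n - 1) ↔ s ≤ ∑ k, m k := by
  have hmin : ∑ k, (s - m k) + ∑ k, min s (m k) = s * (n - 1) + s := by
    rw [← Finset.sum_add_distrib, Finset.sum_congr rfl fun k _ =>
      (show s - m k + min s (m k) = s by omega), Finset.sum_const, Finset.card_univ,
      Fintype.card_fin, smul_eq_mul, ← Nat.mul_succ, Nat.succ_eq_add_one, Nat.sub_add_cancel hn,
      mul_comm]
  -- Truncating at `s` is harmless: a single term with `s ≤ m k` already contributes `s`, and
  -- otherwise nothing is truncated.
  have key : s ≤ ∑ k, min s (m k) ↔ s ≤ ∑ k, m k := by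
    refine ⟨fun h => h.trans (Finset.sum_le_sum fun k _ => min_le_right _ _), fun h => ?_⟩
    by_cases hk : ∃ k, s ≤ m k
    · obtain ⟨k, hk⟩ := hk
      calc s = min s (m k) := (min_eq_left hk).symm
        _ ≤ _ := Finset.single_le_sum (f := fun k => min s (m k)) (fun _ _ => Nat.zero_le _)
          (Finset.mem_univ k)
    · push Not at hk
      rwa [Finset.sum_congr rfl fun k _ => min_eq_right (hk k).le]
  omega

/-! ### Regular matrix polynomials and the conclusion -/

theorem IsRegular.smithDiagonal_ne_zero {n : ℕ} {P : Matrix (Fin n) (Fin n) ℂ[X]}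
    (hP : IsRegular P) (k : Fin n) : smithDiagonal P k ≠ 0 := by
  classical
  have h : (Finset.univ.filter fun i => smithDiagonal P i ≠ 0).card =
      (Finset.univ : Finset (Fin n)).card := by
    rw [Finset.card_univ, Fintype.card_fin]
    exact Eq.trans (by rw [normalRank]) hP
  exact Finset.filter_card_eq h k (Finset.mem_univ k)

theorem isEigenvalue_of_algebraicMultiplicity_pos {n : ℕ} {P : Matrix (Fin n) (Fin n) ℂ[X]}
    {z : ℂ} (h : 0 < algebraicMultiplicity P z) : IsEigenvalue P z := by
  classical
  rw [algebraicMultiplicity, Finset.sum_pos_iff] at h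
  obtain ⟨i, hi, hpos⟩ := h
  exact ⟨_, hpos, i, (Finset.mem_filter.mp hi).2, rfl⟩

theorem IsRegular.algebraicMultiplicity_eq {n : ℕ} {P : Matrix (Fin n) (Fin n) ℂ[X]}
    (hP : IsRegular P) (z : ℂ) :
    algebraicMultiplicity P z = ∑ k, (smithDiagonal P k).rootMultiplicity z := by
  rw [algebraicMultiplicity, Finset.filter_true_of_mem fun k _ => hP.smithDiagonal_ne_zero k]

theorem IsRegular.rank_blockToeplitz {n r : ℕ} {P : Matrix (Fin n) (Fin n) ℂ[X]}
    (hP : IsRegular P) {γ : Fin r → ℝ} (hγ : ∀ i, γ i ≠ 0) (z : ℂ) :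
    (blockToeplitz γ P z).rank =
      ∑ k, (r + 1 - (smithDiagonal P k).rootMultiplicity z) := by
  obtain ⟨E, F, hE, hF, hEF⟩ := (Classical.choose_spec (exists_isSmithDiagonal P)).1
  rw [MatPoly.rank_blockToeplitz hγ, ← rank_matTaylorToeplitz_diagonal z hP.smithDiagonal_ne_zero,
    ← rank_map_mul_mul z (hE.isUnit.map _) (hF.isUnit.map _) (Matrix.diagonal _)]
  exact congrArg (fun A => (matTaylorToeplitz n r z A).rank) hEF

end MatPoly

theorem mainTheorem3 (n r : ℕ) (hn : 0 < n) (P : Matrix (Fin n) (Fin n) (Polynomial ℂ))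
    (hP : MatPoly.IsRegular P) (γ : Fin r → ℝ) (hγ : ∀ i, 0 < γ i) (z : ℂ) :
    (MatPoly.IsEigenvalue P z ∧ r + 1 ≤ MatPoly.algebraicMultiplicity P z) ↔
      (MatPoly.blockToeplitz γ P z).rank ≤ (r + 1) * (n - 1) := by
  rw [hP.rank_blockToeplitz (fun i => (hγ i).ne'), MatPoly.sum_tsub_le_iff hn,
    ← hP.algebraicMultiplicity_eq]
  -- Multiplicity at least `r + 1` is positive, which already forces `z` to be an eigenvalue.
  exact ⟨And.right, fun h =>
    ⟨MatPoly.isEigenvalue_of_algebraicMultiplicity_pos (Nat.lt_of_lt_of_le r.succ_pos h), h⟩⟩
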